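/- For a prime $p$ and an integer $u$ with $p\nmid u$, let $q_p(u)$ be the unique integer with $q_p(u)\equiv \frac{u^{p-1}-1}{p} \pmod p$ and $0\le q_p(u)\le p-1$; put $q_p(u)=0$ if $p\mid u$. For a finite sequence $\Gamma$ of $N$ points in $[0,1)^s$, let $$\Delta(\Gamma)=\sup_{B}\left|\frac{T_\Gamma(B)}{N}-|B|\right|$$ be its discrepancy, where $B=[\alpha_1,\beta_1)\times\cdots\times[\alpha_s,\beta_s)$ runs over all boxes contained in $[0,1)^s$, $|B|$ is the volume of $B$, and $T_\Gamma(B)$ is the number of terms of $\Gamma$ that lie in $B$. For a prime $p$, integers $s\ge 1$, $N\ge 1$ and $M\in\mathbb Z$, let $\Delta_{p,s}(M,N)$ be the discrepancy of the points $$\left(\frac{q_p(u)}{p},\ldots,\frac{q_p(u+s-1)}{p}\right),\qquad u=M+1,\ldots,M+N .$$ Let $s\ge 1$ be fixed. Then there is a constant $C>0$, depending only on $s$, such that $$\Delta_{p,s}(M,N)\le C\,N^{-1}p(\log p)^{s+1}$$ for all primes $p$, all integers $M$ and all integers $N$ with $1\le N<p^2$. In particular the bound is nontrivial for $N\ge p^{1+\varepsilon}$: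 for every fixed $\varepsilon>0$, $\Delta_{p,s}(M,N)\to 0$ as $p\to\infty$ through the primes, uniformly over all integers $M$ and all integers $N$ with $p^{1+\varepsilon}\le N<p^2$. -/

import Mathlib

/-- The Fermat quotient `q_p(u)`: it is `0` when `p ∣ u`, and otherwise the residue of the integer
`(u ^ (p - 1) - 1) / p` modulo `p` in `{0, …, p - 1}`. For a prime `p` not dividing `u` the
division by `p` is exact. -/
def fermatQuotient (p : ℕ) (u : ℤ) : ℤ :=
  if (p : ℤ) ∣ u then 0 else ((u ^ (p - 1) - 1) / (p : ℤ)) % (p : ℤ)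

/-- The half-open box `[α₁, β₁) × ⋯ × [α_s, β_s)`. -/
def halfOpenBox {s : ℕ} (α β : Fin s → ℝ) : Set (Fin s → ℝ) :=
  {x | ∀ j, α j ≤ x j ∧ x j < β j}

open Classical in
/-- The number of terms of the finite sequence `Γ` (counted with multiplicity) lying in `B`. -/
noncomputable def countIn {s N : ℕ} (Γ : Fin N → Fin s → ℝ) (B : Set (Fin s → ℝ)) : ℕ :=
  (Finset.univ.filter fun n : Fin N => Γ n ∈ B).card

/-- The values `|T_Γ(B) / N - |B||`, for `B` ranging over the half-open boxes in `[0,1)^s`. -/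
def discrepancyValues {s N : ℕ} (Γ : Fin N → Fin s → ℝ) : Set ℝ :=
  {d | ∃ α β : Fin s → ℝ, (∀ j, 0 ≤ α j ∧ α j ≤ β j ∧ β j ≤ 1) ∧
    d = |(countIn Γ (halfOpenBox α β) : ℝ) / (N : ℝ) - ∏ j, (β j - α j)|}

/-- The discrepancy of a finite sequence of `N` points in the `s`-dimensional unit cube. -/
noncomputable def discrepancy {s N : ℕ} (Γ : Fin N → Fin s → ℝ) : ℝ :=
  sSup (discrepancyValues Γ)

/-- The supremum defining the discrepancy is over a set that is nonempty and bounded by `1`. -/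
theorem discrepancyValues_nonempty_bounded {s N : ℕ} (Γ : Fin N → Fin s → ℝ) :
    (discrepancyValues Γ).Nonempty ∧ ∀ d ∈ discrepancyValues Γ, 0 ≤ d ∧ d ≤ 1 := by
  classical
  refine ⟨⟨_, 0, 0, fun j => by simp, rfl⟩, ?_⟩
  rintro d ⟨α, β, h, rfl⟩
  refine ⟨abs_nonneg _, ?_⟩
  have h0 : 0 ≤ ∏ j, (β j - α j) :=
    Finset.prod_nonneg fun j _ => by linarith [(h j).2.1]
  have h1 : ∏ j, (β j - α j) ≤ 1 :=
    Finset.prod_le_one (fun j _ => by linarith [(h j).2.1])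
      (fun j _ => by linarith [(h j).1, (h j).2.2])
  have h2 : (0 : ℝ) ≤ (countIn Γ (halfOpenBox α β) : ℝ) / (N : ℝ) := by positivity
  have h3 : (countIn Γ (halfOpenBox α β) : ℝ) / (N : ℝ) ≤ 1 := by
    apply div_le_one_of_le₀ _ (Nat.cast_nonneg N)
    have : countIn Γ (halfOpenBox α β) ≤ N := by
      unfold countIn
      exact (Finset.card_le_univ _).trans (by simp)
    exact_mod_cast this
  rw [abs_le]
  constructor <;> linarith

/-- The points `(q_p(u)/p, …, q_p(u+s-1)/p)` for `u = M+1, …, M+N`, where the term with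
index `n ∈ {0, …, N-1}` corresponds to `u = M + 1 + n`. -/
noncomputable def fermatPoints (p s : ℕ) (M : ℤ) (N : ℕ) : Fin N → Fin s → ℝ :=
  fun n j => (fermatQuotient p (M + 1 + (n : ℕ) + (j : ℕ)) : ℝ) / (p : ℝ)

/-! Expanding `(u + kp)^(p-1)` to first order in `p` gives `q(u + kp) ≡ q(u) - k u⁻¹ (mod p)`, valid
also for `p ∣ u` with `0⁻¹ = 0`. Hence, for a nonzero vector `a`, the combination `∑ a_j q(u + j)`
has period `p²` and along `u = v + kp` is affine in `k`, with slope `-R(v)`, where `R(v) = ∑ a_j /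
(v + j)`.

In a complete exponential sum modulo `p²` with a linear twist, the sum over `k` vanishes unless
`R(v)` takes one prescribed value. This happens for at most `2s` residues `v`
(`card_sum_mul_inv_add_eq_le`), each contributing at most `p`, so the sum is at most `2sp`
(`norm_sum_fermatLinear_le`).

Completion (`ZMod.norm_sum_interval_le`) passes to intervals at the cost of one logarithm. Expanding
the indicator of a box into characters (`ZMod.abs_card_box_sub_le`) costs `s` more. Rounding real
boxes to the grid `p⁻¹ℤ` adds `s / p`, which is absorbed because `N < p²`. -/

/-! ### Characters of `ZMod m` and completion of sums -/

open Finset in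
/-- Orthogonality: the indicator of `x = y` in `ZMod m` as a normalised sum of characters. -/
theorem ZMod.inv_mul_sum_stdAddChar {m : ℕ} [NeZero m] (x y : ZMod m) :
    (m : ℂ)⁻¹ * ∑ b : ZMod m, ZMod.stdAddChar (b * (x - y)) = if x = y then 1 else 0 := by
  rw [AddChar.sum_mulShift _ (ZMod.isPrimitive_stdAddChar m)]
  have hm : (m : ℂ) ≠ 0 := Nat.cast_ne_zero.2 (NeZero.ne m)
  by_cases h : x = y
  · simp [h, ZMod.card, hm]
  · simp [h, sub_eq_zero]

theorem ZMod.sum_univ_eq_sum_range {M : Type*} [AddCommMonoid M] (m : ℕ) [NeZero m]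
    (f : ZMod m → M) : ∑ x, f x = ∑ i ∈ Finset.range m, f (i : ZMod m) := by
  rw [← Fin.sum_univ_eq_sum_range (fun i => f (i : ZMod m)) m]
  refine (Fintype.sum_equiv (ZMod.finEquiv m).toEquiv _ _ fun i => ?_).symm
  congr 1
  obtain ⟨k, rfl⟩ : ∃ k, m = k + 1 := Nat.exists_eq_succ_of_ne_zero (NeZero.ne m)
  exact (Fin.cast_val_eq_self i)

/-- A geometric sum of additive characters is bounded by the inverse distance to the integers. -/
theorem ZMod.norm_sum_range_stdAddChar_le {m : ℕ} [NeZero m] (N b : ℕ) (hb : 1 ≤ b)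
    (hbm : b < m) (c : ZMod m) :
    ‖∑ n ∈ Finset.range N, ZMod.stdAddChar ((b : ZMod m) * (c + (n : ZMod m)))‖ ≤
      (m : ℝ) / 2 * ((b : ℝ)⁻¹ + ((m - b : ℕ) : ℝ)⁻¹) := by
  set z : ℂ := ZMod.stdAddChar (b : ZMod m) with hz
  have hm : (0 : ℝ) < m := by exact_mod_cast (by omega : 0 < m)
  have hb0 : (0 : ℝ) < b := by exact_mod_cast hb
  have hmb : (0 : ℝ) < ((m - b : ℕ) : ℝ) := by exact_mod_cast (by omega : 0 < m - b)
  have hmb' : ((m - b : ℕ) : ℝ) = m - b := Nat.cast_sub hbm.le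
  have hz1 : ‖z‖ = 1 := AddChar.norm_apply _ _
  have hsum : ∑ n ∈ Finset.range N, (ZMod.stdAddChar ((b : ZMod m) * (c + (n : ZMod m))) : ℂ) =
      ZMod.stdAddChar ((b : ZMod m) * c) * ∑ n ∈ Finset.range N, z ^ n := by
    rw [Finset.mul_sum]
    refine Finset.sum_congr rfl fun n _ => ?_
    rw [mul_add, AddChar.map_add_eq_mul, hz, ← AddChar.map_nsmul_eq_pow, nsmul_eq_mul, mul_comm (n : ZMod m)]
  rw [hsum, norm_mul, AddChar.norm_apply, one_mul]
  have hzb : z = Complex.exp (Complex.I * ((2 * Real.pi * b / m : ℝ) : ℂ)) := by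
    rw [hz, show (b : ZMod m) = ((b : ℤ) : ZMod m) by simp, ZMod.stdAddChar_coe]
    congr 1
    push_cast
    ring
  have hnum : ‖z ^ N - 1‖ ≤ 2 := by
    refine (norm_sub_le _ _).trans ?_
    simp [hz1]
    norm_num
  have hprod : ‖z - 1‖ * ‖∑ n ∈ Finset.range N, z ^ n‖ ≤ 2 := by
    rw [← norm_mul, mul_geom_sum]
    exact hnum
  have hsin : ‖z - 1‖ = 2 * |Real.sin (Real.pi * b / m)| := by
    rw [hzb, Complex.norm_exp_I_mul_ofReal_sub_one, norm_mul, Real.norm_eq_abs, Real.norm_eq_abs,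
      abs_two]
    congr 3
    ring
  -- Jordan's inequality `sin x ≥ 2x/π` needs `x ≤ π/2`, so it is applied with `d` the smaller of
  -- `b` and `m - b`; the stated bound keeps both reciprocals to avoid a minimum.
  have key : ∀ d : ℝ, 0 < d → 2 * d ≤ m → |Real.sin (Real.pi * b / m)| = |Real.sin (Real.pi * d / m)| →
      ‖∑ n ∈ Finset.range N, z ^ n‖ ≤ (m : ℝ) / 2 * d⁻¹ := by
    intro d hd hdm hs
    have h1 : 2 / Real.pi * (Real.pi * d / m) ≤ Real.sin (Real.pi * d / m) := by
      apply Real.mul_le_sin (by positivity)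
      rw [div_le_div_iff₀ hm two_pos]
      nlinarith [Real.pi_pos]
    have h2 : 2 / Real.pi * (Real.pi * d / m) = 2 * d / m := by
      field_simp
    have h3 : 4 * d / m ≤ ‖z - 1‖ := by
      rw [hsin, hs]
      have := h1.trans (le_abs_self _)
      rw [h2] at this
      calc 4 * d / m = 2 * (2 * d / m) := by ring
        _ ≤ _ := by linarith
    have h4 : 4 * d / m * ‖∑ n ∈ Finset.range N, z ^ n‖ ≤ 2 :=
      (mul_le_mul_of_nonneg_right h3 (norm_nonneg _)).trans hprod
    have h5 : (0 : ℝ) < 4 * d / m := by positivity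
    calc _ ≤ 2 / (4 * d / m) := by rw [le_div_iff₀' h5]; exact h4
      _ = _ := by field_simp; norm_num
  rcases le_total (2 * (b : ℝ)) m with h | h
  · refine (key b hb0 h rfl).trans ?_
    gcongr
    simp
  · refine (key (m - b : ℕ) hmb (by rw [hmb']; linarith) ?_).trans ?_
    · rw [hmb', show Real.pi * (m - b) / m = Real.pi - Real.pi * b / m by field_simp,
        Real.sin_pi_sub]
    · gcongr
      simp

/-- The frequency `b = 0` contributes `N ≤ m`. The others give two copies of a harmonic sum, one
reflected by `b ↦ m - b`. -/
theorem ZMod.sum_norm_sum_range_stdAddChar_le {m : ℕ} [NeZero m] {N : ℕ} (hN : N ≤ m)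
    (c : ZMod m) :
    ∑ b : ZMod m, ‖∑ n ∈ Finset.range N, ZMod.stdAddChar (b * (c + (n : ZMod m)))‖ ≤
      m * (2 + Real.log m) := by
  obtain ⟨k, rfl⟩ : ∃ k, m = k + 1 := Nat.exists_eq_succ_of_ne_zero (NeZero.ne m)
  rw [ZMod.sum_univ_eq_sum_range, Finset.sum_range_succ']
  have h0 : ‖∑ n ∈ Finset.range N,
      ZMod.stdAddChar (((0 : ℕ) : ZMod (k + 1)) * (c + (n : ZMod (k + 1))))‖ ≤ ((k + 1 : ℕ) : ℝ) := by
    simp only [Nat.cast_zero, zero_mul, AddChar.map_zero_eq_one, Finset.sum_const, Finset.card_range,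
      nsmul_eq_mul, mul_one, Complex.norm_natCast]
    exact_mod_cast hN
  have hH : (∑ i ∈ Finset.range k, (((i + 1 : ℕ) : ℝ))⁻¹) ≤ 1 + Real.log ((k + 1 : ℕ) : ℝ) := by
    have := harmonic_le_one_add_log k
    have h2 : ((harmonic k : ℚ) : ℝ) = ∑ i ∈ Finset.range k, (((i + 1 : ℕ) : ℝ))⁻¹ := by
      simp [harmonic]
    rw [h2] at this
    refine this.trans ?_
    rcases Nat.eq_zero_or_pos k with rfl | hk
    · simp
    · have : (0 : ℝ) < k := by exact_mod_cast hk
      gcongr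
      simp
  have hR : (∑ i ∈ Finset.range k, (((k + 1 - (i + 1) : ℕ) : ℝ))⁻¹) =
      ∑ i ∈ Finset.range k, (((i + 1 : ℕ) : ℝ))⁻¹ := by
    rw [← Finset.sum_range_reflect (fun i => (((i + 1 : ℕ) : ℝ))⁻¹)]
    refine Finset.sum_congr rfl fun i hi => ?_
    rw [Finset.mem_range] at hi
    congr 2
    omega
  have hs : ∑ i ∈ Finset.range k, ‖∑ n ∈ Finset.range N,
      ZMod.stdAddChar (((i + 1 : ℕ) : ZMod (k + 1)) * (c + (n : ZMod (k + 1))))‖ ≤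
      ((k + 1 : ℕ) : ℝ) / 2 * (2 * (1 + Real.log ((k + 1 : ℕ) : ℝ))) := by
    calc _ ≤ ∑ i ∈ Finset.range k, ((k + 1 : ℕ) : ℝ) / 2 *
          ((((i + 1 : ℕ) : ℝ))⁻¹ + (((k + 1 - (i + 1) : ℕ) : ℝ))⁻¹) := by
          refine Finset.sum_le_sum fun i hi => ?_
          rw [Finset.mem_range] at hi
          exact ZMod.norm_sum_range_stdAddChar_le N (i + 1) (by omega) (by omega) c
      _ ≤ _ := by
          rw [← Finset.mul_sum, Finset.sum_add_distrib, hR]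
          gcongr
          linarith
  calc _ ≤ ((k + 1 : ℕ) : ℝ) / 2 * (2 * (1 + Real.log ((k + 1 : ℕ) : ℝ))) + ((k + 1 : ℕ) : ℝ) :=
        add_le_add hs h0
    _ = _ := by ring

/-- Completion of incomplete sums: a uniform bound on all twisted complete sums of `g` over `ZMod m`
bounds the sums of `g` over intervals, up to a logarithm. -/
theorem ZMod.norm_sum_interval_le {m : ℕ} [NeZero m] (g : ZMod m → ℂ) {K : ℝ}
    (hK : ∀ b : ZMod m, ‖∑ x, g x * ZMod.stdAddChar (b * x)‖ ≤ K) {N : ℕ} (hN : N ≤ m)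
    (c : ZMod m) :
    ‖∑ n ∈ Finset.range N, g (c + (n : ZMod m))‖ ≤ K * (2 + Real.log m) := by
  have hm : (0 : ℝ) < m := by exact_mod_cast Nat.pos_of_ne_zero (NeZero.ne m)
  have hK0 : 0 ≤ K := (norm_nonneg _).trans (hK 0)
  have hexp : ∑ n ∈ Finset.range N, g (c + (n : ZMod m)) = (m : ℂ)⁻¹ * ∑ b : ZMod m,
      (∑ x, g x * ZMod.stdAddChar ((-b) * x)) *
        ∑ n ∈ Finset.range N, ZMod.stdAddChar (b * (c + (n : ZMod m))) := by
    calc _ = ∑ n ∈ Finset.range N, ∑ x, g x * (if c + (n : ZMod m) = x then 1 else 0) := by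
          simp
      _ = ∑ n ∈ Finset.range N, ∑ x, g x * ((m : ℂ)⁻¹ * ∑ b : ZMod m,
            ZMod.stdAddChar (b * (c + (n : ZMod m) - x))) := by
          simp_rw [ZMod.inv_mul_sum_stdAddChar]
      _ = ∑ n ∈ Finset.range N, ∑ x, ∑ b : ZMod m, (m : ℂ)⁻¹ * (g x * ZMod.stdAddChar ((-b) * x) *
            ZMod.stdAddChar (b * (c + (n : ZMod m)))) := by
          refine Finset.sum_congr rfl fun n _ => Finset.sum_congr rfl fun x _ => ?_
          rw [Finset.mul_sum, Finset.mul_sum]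
          refine Finset.sum_congr rfl fun b _ => ?_
          rw [show b * (c + (n : ZMod m) - x) = (-b) * x + b * (c + (n : ZMod m)) by ring, AddChar.map_add_eq_mul]
          ring
      _ = _ := by
          rw [Finset.sum_congr rfl fun n _ => Finset.sum_comm, Finset.sum_comm, Finset.mul_sum]
          refine Finset.sum_congr rfl fun b _ => ?_
          rw [Finset.sum_comm, Finset.sum_mul_sum, Finset.mul_sum]
          refine Finset.sum_congr rfl fun x _ => ?_
          rw [Finset.mul_sum]
  rw [hexp, norm_mul, norm_inv, Complex.norm_natCast]
  calc _ ≤ (m : ℝ)⁻¹ * ∑ b : ZMod m, K *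
        ‖∑ n ∈ Finset.range N, ZMod.stdAddChar (b * (c + (n : ZMod m)))‖ := by
        gcongr
        refine (norm_sum_le _ _).trans (Finset.sum_le_sum fun b _ => ?_)
        rw [norm_mul]
        gcongr
        exact hK (-b)
    _ ≤ (m : ℝ)⁻¹ * (K * (m * (2 + Real.log m))) := by
        rw [← Finset.mul_sum]
        gcongr
        exact ZMod.sum_norm_sum_range_stdAddChar_le hN c
    _ = _ := by field_simp

/-! ### Fermat quotients under translation -/

theorem fermatQuotient_eq_of_mul_eq {p : ℕ} {u a : ℤ} (hp : p.Prime) (hu : ¬ (p : ℤ) ∣ u)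
    (h : u ^ (p - 1) = 1 + p * a) : (fermatQuotient p u : ZMod p) = a := by
  have hp0 : (p : ℤ) ≠ 0 := by exact_mod_cast hp.ne_zero
  rw [fermatQuotient, if_neg hu, h, add_sub_cancel_left, Int.mul_ediv_cancel_left _ hp0,
    ZMod.intCast_mod]

theorem exists_pow_sub_one_eq {p : ℕ} {u : ℤ} (hp : p.Prime) (hu : ¬ (p : ℤ) ∣ u) :
    ∃ a : ℤ, u ^ (p - 1) = 1 + p * a := by
  have hc : IsCoprime u (p : ℤ) :=
    ((Prime.coprime_iff_not_dvd (Nat.prime_iff_prime_int.1 hp)).2 hu).symm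
  obtain ⟨a, ha⟩ := (Int.ModEq.pow_card_sub_one_eq_one hp hc).symm.dvd
  exact ⟨a, by linarith⟩

/-- The Fermat quotient modulo `p` under translation by multiples of `p`; since `0⁻¹ = 0`, the
formula also covers `p ∣ u`. -/
theorem fermatQuotient_add_mul {p : ℕ} [Fact p.Prime] (u k : ℤ) :
    (fermatQuotient p (u + k * p) : ZMod p) =
      (fermatQuotient p u : ZMod p) - (k : ZMod p) * (u : ZMod p)⁻¹ := by
  have hp : p.Prime := Fact.out
  by_cases hu : (p : ℤ) ∣ u
  · have h2 : (p : ℤ) ∣ u + k * p := dvd_add hu (dvd_mul_left _ _)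
    rw [fermatQuotient, fermatQuotient, if_pos hu, if_pos h2,
      (ZMod.intCast_zmod_eq_zero_iff_dvd u p).2 hu]
    simp
  · have h2 : ¬ (p : ℤ) ∣ u + k * p := fun h => hu ((Int.dvd_add_left (dvd_mul_left _ _)).1 h)
    have hu0 : (u : ZMod p) ≠ 0 := fun h => hu ((ZMod.intCast_zmod_eq_zero_iff_dvd u p).1 h)
    obtain ⟨a, ha⟩ := exists_pow_sub_one_eq hp hu
    -- Second-order terms carry `p²` and vanish after division by `p` and reduction. The linear
    -- coefficient `(p - 1) u^(p-2)` becomes `-u⁻¹`.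
    obtain ⟨c, hc⟩ := Polynomial.powAddExpansion u (k * p) (p - 1)
    have h3 : (u + k * p) ^ (p - 1) =
        1 + p * (a + ((p - 1 : ℕ) : ℤ) * u ^ (p - 1 - 1) * k + c * k ^ 2 * p) := by
      rw [hc, ha]
      ring
    rw [fermatQuotient_eq_of_mul_eq hp h2 h3, fermatQuotient_eq_of_mul_eq hp hu ha]
    have h4 : (u : ZMod p) ^ (p - 1 - 1) = (u : ZMod p)⁻¹ := by
      refine eq_inv_of_mul_eq_one_left ?_
      rw [← pow_succ, show p - 1 - 1 + 1 = p - 1 by have := hp.two_le; omega]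
      exact ZMod.pow_card_sub_one_eq_one hu0
    have h5 : ((p - 1 : ℕ) : ZMod p) = -1 := by
      rw [Nat.cast_sub hp.one_lt.le]
      simp
    push_cast
    rw [h4, h5]
    simp
    ring

/-- The linear combination `∑ a_j q_p(u + j)` modulo `p`. -/
noncomputable def fermatLinear {p s : ℕ} (a : Fin s → ZMod p) (u : ℤ) : ZMod p :=
  ∑ j, a j * (fermatQuotient p (u + (j : ℕ)) : ZMod p)

theorem fermatLinear_add_mul {p s : ℕ} [Fact p.Prime] (a : Fin s → ZMod p) (u k : ℤ) :
    fermatLinear a (u + k * p) =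
      fermatLinear a u - k * ∑ j, a j * ((u : ZMod p) + ((j : ℕ) : ZMod p))⁻¹ := by
  rw [fermatLinear, fermatLinear, Finset.mul_sum, ← Finset.sum_sub_distrib]
  refine Finset.sum_congr rfl fun j _ => ?_
  rw [add_right_comm, fermatQuotient_add_mul]
  push_cast
  ring

/-- A shift by `p²` is `k` shifts by `p` with `p ∣ k`, so the linear correction is zero modulo `p`.
-/
theorem fermatLinear_emod_sq {p s : ℕ} [Fact p.Prime] (a : Fin s → ZMod p) {u v : ℤ}
    (h : (u : ZMod (p ^ 2)) = v) : fermatLinear a u = fermatLinear a v := by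
  obtain ⟨k, hk⟩ := (ZMod.intCast_eq_intCast_iff_dvd_sub u v (p ^ 2)).1 h
  have : v = u + (p * k) * p := by
    push_cast at hk
    linarith
  rw [this, fermatLinear_add_mul]
  simp

/-! ### Complete sums modulo `p²` -/

open Finset Polynomial in
/-- A nontrivial combination of the functions `1 / (v + j)` takes each value at most `2 s` times. -/
theorem card_sum_mul_inv_add_eq_le {p s : ℕ} [Fact p.Prime] (hs : s ≤ p) (a : Fin s → ZMod p)
    (ha : a ≠ 0) (b : ZMod p) :
    #{v : ZMod p | ∑ j, a j * (v + ((j : ℕ) : ZMod p))⁻¹ = b} ≤ 2 * s := by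
  classical
  obtain ⟨i, hi⟩ := Function.ne_iff.1 ha
  let L : Fin s → (ZMod p)[X] := fun j => X + C ((j : ℕ) : ZMod p)
  let D : (ZMod p)[X] := ∏ j, L j
  -- `P` is the equation with denominators cleared. The poles `v = -j`, where the convention `0⁻¹ =
  -- 0` intervenes, are counted separately as roots of `D`; hence `s + s`.
  let P : (ZMod p)[X] := ∑ j, C (a j) * ∏ l ∈ univ.erase j, L l - C b * D
  have hLdeg : ∀ j, (L j).natDegree = 1 := fun j => natDegree_X_add_C _
  have hLmon : ∀ j, (L j).Monic := fun j => monic_X_add_C _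
  have hDdeg : D.natDegree ≤ s := by
    refine (natDegree_prod_le _ _).trans ?_
    simp [hLdeg]
  have hPdeg : P.natDegree ≤ s := by
    refine (natDegree_sub_le _ _).trans (max_le (natDegree_sum_le_of_forall_le _ _ fun j _ => ?_)
      ((natDegree_C_mul_le _ _).trans hDdeg))
    refine (natDegree_C_mul_le _ _).trans ((natDegree_prod_le _ _).trans ?_)
    simp only [hLdeg, sum_const, smul_eq_mul, mul_one]
    exact (card_le_univ _).trans (by simp)
  have hinj : ∀ l j : Fin s, ((l : ℕ) : ZMod p) = ((j : ℕ) : ZMod p) → l = j := by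
    intro l j h
    rw [ZMod.natCast_eq_natCast_iff'] at h
    rw [Nat.mod_eq_of_lt (l.2.trans_le hs), Nat.mod_eq_of_lt (j.2.trans_le hs)] at h
    exact Fin.ext h
  -- At the pole `-i` only the term `j = i` survives, with value `a_i ∏ (l - i)` over `l ≠ i`; it is
  -- nonzero since `s ≤ p` makes the shifts distinct modulo `p`.
  have hP0 : P ≠ 0 := by
    intro h
    have h1 : P.eval (-((i : ℕ) : ZMod p)) = 0 := by rw [h, eval_zero]
    have hD : D.eval (-((i : ℕ) : ZMod p)) = 0 := by
      rw [eval_prod]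
      exact prod_eq_zero (mem_univ i) (by simp [L])
    rw [eval_sub, eval_mul, hD, mul_zero, sub_zero, eval_finsetSum, sum_eq_single i] at h1
    · rw [eval_mul, eval_C, eval_prod] at h1
      rcases mul_eq_zero.1 h1 with h1 | h1
      · exact hi h1
      · obtain ⟨l, hl, hl0⟩ := prod_eq_zero_iff.1 h1
        refine (mem_erase.1 hl).1 (hinj l i ?_)
        simp only [L, eval_add, eval_X, eval_C] at hl0
        linear_combination hl0
    · intro j _ hj
      rw [eval_mul, eval_prod, prod_eq_zero (i := i) (by simp [hj.symm]) (by simp [L]), mul_zero]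
    · simp
  have hD0 : D ≠ 0 := (monic_prod_of_monic _ _ fun j _ => hLmon j).ne_zero
  have hPD : P * D ≠ 0 := mul_ne_zero hP0 hD0
  refine (card_le_degree_of_subset_roots (p := P * D) ?_).trans
    (natDegree_mul_le.trans (by omega))
  intro v hv
  rw [mem_roots hPD, IsRoot, eval_mul]
  have hv' : ∑ j, a j * (v + ((j : ℕ) : ZMod p))⁻¹ = b := by simpa using hv
  by_cases h0 : D.eval v = 0
  · rw [h0, mul_zero]
  · have hne : ∀ j : Fin s, v + ((j : ℕ) : ZMod p) ≠ 0 := by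
      intro j hj
      refine h0 ?_
      rw [eval_prod]
      exact prod_eq_zero (mem_univ j) (by simpa [L] using hj)
    have : P.eval v = 0 := by
      rw [eval_sub, eval_mul, eval_C, eval_finsetSum, ← hv', sum_mul, sub_eq_zero]
      refine sum_congr rfl fun j _ => ?_
      rw [eval_mul, eval_C, show D = L j * ∏ l ∈ univ.erase j, L l from
        (mul_prod_erase _ _ (mem_univ j)).symm, eval_mul, mul_assoc]
      have : (L j).eval v = v + ((j : ℕ) : ZMod p) := by simp [L]
      rw [this, inv_mul_cancel_left₀ (hne j)]
    rw [this, zero_mul]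

theorem Finset.sum_range_mul_eq {M : Type*} [AddCommMonoid M] (m n : ℕ) (f : ℕ → M) :
    ∑ i ∈ Finset.range (m * n), f i = ∑ v ∈ Finset.range n, ∑ k ∈ Finset.range m, f (v + k * n) := by
  rw [Finset.sum_comm]
  induction m with
  | zero => simp
  | succ m ih =>
    rw [Finset.sum_range_succ, ← ih, add_mul, one_mul, Finset.sum_range_add]
    congr 1
    exact Finset.sum_congr rfl fun v _ => by rw [add_comm]

theorem ZMod.stdAddChar_mul_natCast_sq {p : ℕ} [NeZero p] (b k : ℕ) :
    ZMod.stdAddChar ((b : ZMod (p ^ 2)) * ((k * p : ℕ) : ZMod (p ^ 2))) =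
      ZMod.stdAddChar ((b : ZMod p) * (k : ZMod p)) := by
  have hp : (p : ℂ) ≠ 0 := Nat.cast_ne_zero.2 (NeZero.ne p)
  rw [show (b : ZMod (p ^ 2)) * ((k * p : ℕ) : ZMod (p ^ 2)) = ((b * (k * p) : ℤ) : ZMod (p ^ 2)) by
      push_cast; ring,
    show (b : ZMod p) * (k : ZMod p) = ((b * k : ℤ) : ZMod p) by push_cast; ring,
    ZMod.stdAddChar_coe, ZMod.stdAddChar_coe]
  congr 1
  push_cast
  field_simp

/-- Complete exponential sums modulo `p ^ 2` with Fermat quotients and a linear twist. -/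
theorem norm_sum_fermatLinear_le {p s : ℕ} [Fact p.Prime] (hs : s ≤ p) (a : Fin s → ZMod p)
    (ha : a ≠ 0) (b : ZMod (p ^ 2)) :
    ‖∑ x : ZMod (p ^ 2), ZMod.stdAddChar (fermatLinear a (x.val : ℤ)) *
      ZMod.stdAddChar (b * x)‖ ≤ 2 * s * p := by
  classical
  rw [ZMod.sum_univ_eq_sum_range]
  set R : ZMod p → ZMod p := fun v => ∑ j, a j * (v + ((j : ℕ) : ZMod p))⁻¹ with hR
  have hterm : ∀ v k : ℕ,
      ZMod.stdAddChar (fermatLinear a ((((v + k * p : ℕ) : ZMod (p ^ 2)).val : ℕ) : ℤ)) *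
        ZMod.stdAddChar (b * ((v + k * p : ℕ) : ZMod (p ^ 2))) =
      (ZMod.stdAddChar (fermatLinear a (v : ℤ)) * ZMod.stdAddChar (b * (v : ZMod (p ^ 2)))) *
        ZMod.stdAddChar ((k : ZMod p) * ((b.val : ZMod p) - R v)) := by
    intro v k
    have h1 : fermatLinear a ((((v + k * p : ℕ) : ZMod (p ^ 2)).val : ℕ) : ℤ) =
        fermatLinear a (v : ℤ) - (k : ZMod p) * R v := by
      rw [fermatLinear_emod_sq a (v := (v : ℤ) + (k : ℤ) * p) (by simp), fermatLinear_add_mul]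
      simp [hR]
    have h2 : ZMod.stdAddChar (b * ((v + k * p : ℕ) : ZMod (p ^ 2))) =
        ZMod.stdAddChar (b * (v : ZMod (p ^ 2))) *
          ZMod.stdAddChar ((b.val : ZMod p) * (k : ZMod p)) := by
      rw [← ZMod.stdAddChar_mul_natCast_sq, ← AddChar.map_add_eq_mul, ZMod.natCast_zmod_val]
      congr 1
      push_cast
      ring
    rw [h1, h2, show fermatLinear a (v : ℤ) - (k : ZMod p) * R v =
      fermatLinear a (v : ℤ) + (-(k : ZMod p) * R v) by ring, AddChar.map_add_eq_mul,
      show (k : ZMod p) * ((b.val : ZMod p) - R v) =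
        -(k : ZMod p) * R v + (b.val : ZMod p) * (k : ZMod p) by ring, AddChar.map_add_eq_mul]
    ring
  -- Write `x = v + kp`; by `hterm` the inner sum over `k` is a complete character sum modulo `p`.
  rw [show Finset.range (p ^ 2) = Finset.range (p * p) by rw [sq], Finset.sum_range_mul_eq]
  simp_rw [hterm, ← Finset.mul_sum]
  calc _ ≤ ∑ v ∈ Finset.range p, ‖∑ k ∈ Finset.range p,
        (ZMod.stdAddChar ((k : ZMod p) * ((b.val : ZMod p) - R v)) : ℂ)‖ := by
        refine (norm_sum_le _ _).trans (Finset.sum_le_sum fun v _ => ?_)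
        rw [norm_mul, norm_mul, AddChar.norm_apply, AddChar.norm_apply, one_mul, one_mul]
    _ = ∑ v : ZMod p, ‖∑ k : ZMod p,
        (ZMod.stdAddChar (k * ((b.val : ZMod p) - R v)) : ℂ)‖ := by
        rw [ZMod.sum_univ_eq_sum_range]
        refine Finset.sum_congr rfl fun v _ => ?_
        rw [ZMod.sum_univ_eq_sum_range]
    _ = ∑ v : ZMod p, if R v = b.val then (p : ℝ) else 0 := by
        refine Finset.sum_congr rfl fun v _ => ?_
        rw [AddChar.sum_mulShift _ (ZMod.isPrimitive_stdAddChar p)]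
        by_cases h : R v = b.val
        · simp [h, ZMod.card]
        · rw [if_neg h, if_neg (fun h' => h (sub_eq_zero.1 h').symm)]
          simp
    _ = (Finset.card {v : ZMod p | R v = b.val} : ℝ) * p := by
        rw [← Finset.sum_filter, Finset.sum_const, nsmul_eq_mul]
    _ ≤ 2 * s * p := by
        gcongr
        exact_mod_cast card_sum_mul_inv_add_eq_le hs a ha _

theorem norm_sum_interval_fermatLinear_le {p s : ℕ} [Fact p.Prime] (hs : s ≤ p)
    (a : Fin s → ZMod p) (ha : a ≠ 0) (M : ℤ) {N : ℕ} (hN : N ≤ p ^ 2) :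
    ‖∑ n ∈ Finset.range N, ZMod.stdAddChar (fermatLinear a (M + n))‖ ≤
      2 * s * p * (2 + 2 * Real.log p) := by
  have h := ZMod.norm_sum_interval_le _ (norm_sum_fermatLinear_le hs a ha) hN (M : ZMod (p ^ 2))
  rw [Nat.cast_pow, Real.log_pow, Nat.cast_ofNat] at h
  convert h using 4 with n
  exact fermatLinear_emod_sq a (by simp)

/-! ### From exponential sums to boxes -/

theorem ZMod.ite_val_mem_Ico_eq {m : ℕ} [NeZero m] (x : ZMod m) {lo hi : ℕ} (hhi : hi ≤ m) :
    (if x.val ∈ Finset.Ico lo hi then (1 : ℂ) else 0) = (m : ℂ)⁻¹ * ∑ b : ZMod m,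
      (∑ i ∈ Finset.range (hi - lo), ZMod.stdAddChar (b * ((lo : ZMod m) + (i : ZMod m)))) *
        ZMod.stdAddChar (-b * x) := by
  calc _ = ∑ i ∈ Finset.range (hi - lo), if lo + i = x.val then (1 : ℂ) else 0 := by
        rw [← Finset.sum_Ico_eq_sum_range (fun i => if i = x.val then (1 : ℂ) else 0)]
        simp
    _ = ∑ i ∈ Finset.range (hi - lo), if (lo : ZMod m) + (i : ZMod m) = x then (1 : ℂ) else 0 := by
        refine Finset.sum_congr rfl fun i hi' => ?_
        rw [Finset.mem_range] at hi'
        have hlt : lo + i < m := by omega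
        have : lo + i = x.val ↔ (lo : ZMod m) + (i : ZMod m) = x := by
          rw [← Nat.cast_add]
          constructor
          · intro h
            rw [h, ZMod.natCast_zmod_val]
          · intro h
            rw [← h, ZMod.val_cast_of_lt hlt]
        simp only [this]
    _ = _ := by
        simp_rw [← ZMod.inv_mul_sum_stdAddChar, ← Finset.mul_sum, Finset.sum_mul]
        rw [Finset.sum_comm]
        congr 1
        refine Finset.sum_congr rfl fun b _ => Finset.sum_congr rfl fun i _ => ?_
        rw [← AddChar.map_add_eq_mul]
        congr 1
        ring

theorem AddChar.map_finset_sum_eq_prod {G R ι : Type*} [AddCommMonoid G] [CommMonoid R]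
    (ψ : AddChar G R) (t : Finset ι) (f : ι → G) : ψ (∑ i ∈ t, f i) = ∏ i ∈ t, ψ (f i) := by
  classical
  induction t using Finset.induction_on with
  | empty => simp
  | insert i t hi ih => rw [Finset.sum_insert hi, Finset.prod_insert hi, map_add_eq_mul, ih]

open Finset in
/-- A discrete Erdős–Turán–Koksma inequality: bounds on nontrivial exponential sums control the
number of terms of a sequence in `(ZMod m) ^ s` lying in a box. -/
theorem ZMod.abs_card_box_sub_le {m s : ℕ} [NeZero m] (N : ℕ) (x : ℕ → Fin s → ZMod m) {K : ℝ}
    (hK0 : 0 ≤ K)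
    (hK : ∀ a : Fin s → ZMod m, a ≠ 0 →
      ‖∑ n ∈ range N, ZMod.stdAddChar (∑ j, a j * x n j)‖ ≤ K)
    (lo hi : Fin s → ℕ) (hhi : ∀ j, hi j ≤ m) :
    |(#{n ∈ range N | ∀ j, (x n j).val ∈ Ico (lo j) (hi j)} : ℝ) -
      N * ∏ j, (((hi j - lo j : ℕ) : ℝ) / m)| ≤ K * (2 + Real.log m) ^ s := by
  have hm : (0 : ℝ) < m := by exact_mod_cast Nat.pos_of_ne_zero (NeZero.ne m)
  set W : Fin s → ZMod m → ℂ := fun j b =>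
    ∑ i ∈ range (hi j - lo j), ZMod.stdAddChar (b * ((lo j : ZMod m) + (i : ZMod m))) with hW
  set S : (Fin s → ZMod m) → ℂ := fun a =>
    ∑ n ∈ range N, ZMod.stdAddChar (∑ j, (-a) j * x n j) with hS
  have hcount : ((#{n ∈ range N | ∀ j, (x n j).val ∈ Ico (lo j) (hi j)} : ℕ) : ℂ) =
      ((m : ℂ)⁻¹) ^ s * ∑ a : Fin s → ZMod m, (∏ j, W j (a j)) * S a := by
    calc _ = ∑ n ∈ range N, ∏ j, if (x n j).val ∈ Ico (lo j) (hi j) then (1 : ℂ) else 0 := by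
          rw [card_filter]
          push_cast
          refine sum_congr rfl fun n _ => ?_
          rw [prod_ite_zero]
          simp
      _ = ∑ n ∈ range N, ((m : ℂ)⁻¹) ^ s * ∑ a : Fin s → ZMod m,
            (∏ j, W j (a j)) * ZMod.stdAddChar (∑ j, (-a) j * x n j) := by
          refine sum_congr rfl fun n _ => ?_
          simp_rw [fun j => ZMod.ite_val_mem_Ico_eq (x n j) (lo := lo j) (hhi j)]
          rw [prod_mul_distrib, prod_const, card_univ, Fintype.card_fin, prod_univ_sum,
            Fintype.piFinset_univ]
          congr 1
          refine sum_congr rfl fun a _ => ?_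
          rw [prod_mul_distrib, AddChar.map_finset_sum_eq_prod]
          rfl
      _ = _ := by
          rw [← mul_sum, sum_comm]
          simp_rw [← mul_sum]
          rfl
  have hzero : (∏ j, W j ((0 : Fin s → ZMod m) j)) * S 0 =
      (∏ j, ((hi j - lo j : ℕ) : ℂ)) * N := by
    simp [hW, hS]
  have hmain : ((#{n ∈ range N | ∀ j, (x n j).val ∈ Ico (lo j) (hi j)} : ℝ) -
      N * ∏ j, (((hi j - lo j : ℕ) : ℝ) / m) : ℝ) =
      ((m : ℂ)⁻¹) ^ s * ∑ a ∈ (univ : Finset (Fin s → ZMod m)).erase 0,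
        (∏ j, W j (a j)) * S a := by
    -- The zero frequency is exactly the expected count `N ∏ (hi - lo) / m`.
    rw [← add_sum_erase _ _ (mem_univ (0 : Fin s → ZMod m)), hzero] at hcount
    push_cast
    rw [hcount, prod_div_distrib, prod_const, card_univ, Fintype.card_fin]
    ring
  rw [← Real.norm_eq_abs, ← Complex.norm_real, hmain, norm_mul, norm_pow, norm_inv,
    Complex.norm_natCast]
  calc _ ≤ ((m : ℝ)⁻¹) ^ s * ∑ a ∈ (univ : Finset (Fin s → ZMod m)).erase 0,
        (∏ j, ‖W j (a j)‖) * K := by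
        gcongr
        refine (norm_sum_le _ _).trans (sum_le_sum fun a ha => ?_)
        rw [norm_mul, norm_prod]
        gcongr
        exact hK (-a) (neg_ne_zero.2 (mem_erase.1 ha).1)
    _ ≤ ((m : ℝ)⁻¹) ^ s * ∑ a : Fin s → ZMod m, (∏ j, ‖W j (a j)‖) * K := by
        gcongr
        exact erase_subset _ _
    _ = ((m : ℝ)⁻¹) ^ s * ((∏ j, ∑ b, ‖W j b‖) * K) := by
        rw [prod_univ_sum, Fintype.piFinset_univ, sum_mul]
    _ ≤ ((m : ℝ)⁻¹) ^ s * ((∏ _j : Fin s, (m * (2 + Real.log m))) * K) := by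
        gcongr with j
        exact ZMod.sum_norm_sum_range_stdAddChar_le ((Nat.sub_le _ _).trans (hhi j)) _
    _ = _ := by
        rw [prod_const, card_univ, Fintype.card_fin, mul_pow, ← mul_assoc, ← mul_assoc, ← mul_pow,
          inv_mul_cancel₀ hm.ne', one_pow, one_mul, mul_comm]

theorem Finset.abs_prod_sub_prod_le_sum {ι : Type*} (t : Finset ι) (f g : ι → ℝ)
    (hf : ∀ i ∈ t, |f i| ≤ 1) (hg : ∀ i ∈ t, |g i| ≤ 1) :
    |∏ i ∈ t, f i - ∏ i ∈ t, g i| ≤ ∑ i ∈ t, |f i - g i| := by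
  classical
  induction t using Finset.induction_on with
  | empty => simp
  | insert i t hi ih =>
    rw [Finset.prod_insert hi, Finset.prod_insert hi, Finset.sum_insert hi]
    have hP : |∏ i ∈ t, f i| ≤ 1 := by
      rw [Finset.abs_prod]
      exact Finset.prod_le_one (fun _ _ => abs_nonneg _)
        fun j hj => hf j (Finset.mem_insert_of_mem hj)
    have := ih (fun j hj => hf j (Finset.mem_insert_of_mem hj))
      (fun j hj => hg j (Finset.mem_insert_of_mem hj))
    calc _ = |(f i - g i) * ∏ i ∈ t, f i + g i * (∏ i ∈ t, f i - ∏ i ∈ t, g i)| := by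
          congr 1
          ring
      _ ≤ |f i - g i| * |∏ i ∈ t, f i| + |g i| * |∏ i ∈ t, f i - ∏ i ∈ t, g i| := by
          rw [← abs_mul, ← abs_mul]
          exact abs_add_le _ _
      _ ≤ |f i - g i| * 1 + 1 * ∑ i ∈ t, |f i - g i| := by
          gcongr
          exact hg i (Finset.mem_insert_self _ _)
      _ = _ := by ring

/-! ### Discrepancy of the Fermat quotient points -/

theorem fermatQuotient_nonneg {p : ℕ} (hp : p ≠ 0) (u : ℤ) : 0 ≤ fermatQuotient p u := by
  unfold fermatQuotient
  split_ifs
  · rfl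
  · exact Int.emod_nonneg _ (by exact_mod_cast hp)

theorem fermatQuotient_lt {p : ℕ} (hp : p ≠ 0) (u : ℤ) : fermatQuotient p u < p := by
  have : (0 : ℤ) < p := by exact_mod_cast Nat.pos_of_ne_zero hp
  unfold fermatQuotient
  split_ifs
  · exact this
  · exact Int.emod_lt_of_pos _ this

theorem val_fermatQuotient {p : ℕ} [NeZero p] (u : ℤ) :
    (((fermatQuotient p u : ZMod p).val : ℕ) : ℤ) = fermatQuotient p u := by
  rw [ZMod.val_intCast]
  exact Int.emod_eq_of_lt (fermatQuotient_nonneg (NeZero.ne p) u) (fermatQuotient_lt (NeZero.ne p) u)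

-- For an integer `q`, `α ≤ q/p < β` means `⌈αp⌉ ≤ q < ⌈βp⌉`, so only the volume, not the count,
-- changes under rounding.
open Finset in
theorem countIn_fermatPoints {p s N : ℕ} [NeZero p] (M : ℤ) (α β : Fin s → ℝ) :
    countIn (fermatPoints p s M N) (halfOpenBox α β) =
      #{n ∈ range N | ∀ j : Fin s, (fermatQuotient p (M + 1 + ((n : ℕ) : ℤ) + (j : ℕ)) : ZMod p).val ∈
        Ico ⌈α j * p⌉₊ ⌈β j * p⌉₊} := by
  classical
  have hp : (0 : ℝ) < p := by exact_mod_cast Nat.pos_of_ne_zero (NeZero.ne p)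
  have hcast : ∀ u : ℤ, (fermatQuotient p u : ℝ) = (((fermatQuotient p u : ZMod p).val : ℕ) : ℝ) :=
    fun u => by exact_mod_cast (val_fermatQuotient u).symm
  rw [countIn, card_filter, card_filter, ← Fin.sum_univ_eq_sum_range
    (fun n : ℕ => if ∀ j : Fin s, (fermatQuotient p (M + 1 + (n : ℕ) + (j : ℕ)) : ZMod p).val ∈
        Ico ⌈α j * p⌉₊ ⌈β j * p⌉₊ then 1 else 0) N]
  refine sum_congr rfl fun n _ => ?_
  congr 1
  simp only [halfOpenBox, fermatPoints, Set.mem_ofPred_eq, mem_Ico, Nat.ceil_le, Nat.lt_ceil,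
    le_div_iff₀ hp, div_lt_iff₀ hp, hcast]

theorem discrepancy_fermatPoints_le_of_le {p s N : ℕ} [Fact p.Prime] (hs : s ≤ p) (M : ℤ)
    (hN0 : 1 ≤ N) (hN : N ≤ p ^ 2) :
    discrepancy (fermatPoints p s M N) ≤
      2 * s * p * (2 + 2 * Real.log p) * (2 + Real.log p) ^ s / N + s / p := by
  have hp : (0 : ℝ) < p := by exact_mod_cast (Fact.out : p.Prime).pos
  have hNR : (0 : ℝ) < N := by exact_mod_cast hN0
  have hlog : 0 ≤ Real.log p := Real.log_natCast_nonneg p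
  refine csSup_le (discrepancyValues_nonempty_bounded _).1 ?_
  rintro d ⟨α, β, h, rfl⟩
  set L : Fin s → ℝ := fun j => ((⌈β j * p⌉₊ - ⌈α j * p⌉₊ : ℕ) : ℝ) / p with hL
  have hhi : ∀ j, ⌈β j * p⌉₊ ≤ p := fun j => by
    rw [Nat.ceil_le]
    nlinarith [(h j).2.2]
  have hcount := ZMod.abs_card_box_sub_le (m := p) N
    (fun n j => (fermatQuotient p (M + 1 + (n : ℕ) + (j : ℕ)) : ZMod p))
    (K := 2 * s * p * (2 + 2 * Real.log p)) (by positivity)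
    (fun a ha => norm_sum_interval_fermatLinear_le hs a ha (M + 1) hN)
    (fun j => ⌈α j * p⌉₊) (fun j => ⌈β j * p⌉₊) hhi
  rw [← countIn_fermatPoints M α β] at hcount
  have hprod : |∏ j, L j - ∏ j, (β j - α j)| ≤ s / p := by
    refine (Finset.abs_prod_sub_prod_le_sum _ _ _ (fun j _ => ?_) fun j _ => ?_).trans ?_
    · rw [abs_of_nonneg (by positivity), div_le_one hp]
      exact_mod_cast (Nat.sub_le _ _).trans (hhi j)
    · rw [abs_le]
      constructor <;> linarith [(h j).1, (h j).2.1, (h j).2.2]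
    · calc _ ≤ ∑ _j : Fin s, 1 / (p : ℝ) := by
            refine Finset.sum_le_sum fun j _ => ?_
            obtain ⟨h0, h1, h2⟩ := h j
            have hle : ⌈α j * p⌉₊ ≤ ⌈β j * p⌉₊ := by gcongr
            have e1 := Nat.le_ceil (α j * p)
            have e2 := Nat.ceil_lt_add_one (a := α j * p) (by positivity)
            have e3 := Nat.le_ceil (β j * p)
            have e4 := Nat.ceil_lt_add_one (a := β j * p)
              (mul_nonneg (h0.trans h1) hp.le)
            rw [hL]
            dsimp only
            rw [Nat.cast_sub hle, show ((⌈β j * p⌉₊ : ℝ) - (⌈α j * p⌉₊ : ℝ)) / p - (β j - α j) =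
              ((⌈β j * p⌉₊ : ℝ) - (⌈α j * p⌉₊ : ℝ) - (β j * p - α j * p)) / p by field_simp,
              abs_div, abs_of_pos hp]
            gcongr
            rw [abs_le]
            constructor <;> linarith
        _ = _ := by simp [div_eq_mul_inv]
  calc |(countIn (fermatPoints p s M N) (halfOpenBox α β) : ℝ) / N - ∏ j, (β j - α j)| =
        |((countIn (fermatPoints p s M N) (halfOpenBox α β) : ℝ) - N * ∏ j, L j) / N +
          (∏ j, L j - ∏ j, (β j - α j))| := by
        congr 1
        field_simp
        ring
    _ ≤ _ := by
        refine (abs_add_le _ _).trans (add_le_add ?_ hprod)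
        rw [abs_div, abs_of_pos hNR]
        gcongr

theorem discrepancy_le_one {s N : ℕ} (Γ : Fin N → Fin s → ℝ) : discrepancy Γ ≤ 1 :=
  csSup_le (discrepancyValues_nonempty_bounded Γ).1
    fun d hd => ((discrepancyValues_nonempty_bounded Γ).2 d hd).2

theorem exists_discrepancy_fermatPoints_le (s : ℕ) (hs : 1 ≤ s) :
    ∃ C : ℝ, 0 < C ∧ ∀ p : ℕ, p.Prime → ∀ (M : ℤ) (N : ℕ), 1 ≤ N → N < p ^ 2 →
      discrepancy (fermatPoints p s M N) ≤
        C * ((N : ℝ)⁻¹ * (p : ℝ) * Real.log (p : ℝ) ^ (s + 1)) := by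
  have hs0 : (0 : ℝ) < s := by exact_mod_cast hs
  -- From `log p ≥ 1/2`: `2 + 2 log p ≤ 6 log p` and `2 + log p ≤ 5 log p`, giving `12 s 5^s`. The
  -- other summand pays for `s / p`, using `1/p ≤ p/N` and `1 ≤ (2 log p)^(s+1)`.
  refine ⟨12 * s * 5 ^ s + s * 2 ^ (s + 1), by positivity, fun p hp M N hN0 hN => ?_⟩
  have : Fact p.Prime := ⟨hp⟩
  have hp0 : (0 : ℝ) < p := by exact_mod_cast hp.pos
  have hNR : (0 : ℝ) < N := by exact_mod_cast hN0
  have hN2 : (N : ℝ) ≤ p * p := by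
    rw [← sq]
    exact_mod_cast hN.le
  have hlog : 1 / 2 ≤ Real.log p := by
    have h2 : Real.log 2 ≤ Real.log p :=
      Real.log_le_log two_pos (by exact_mod_cast hp.two_le)
    linarith [Real.log_two_gt_d9]
  have hlog0 : 0 < Real.log p := by linarith
  set E : ℝ := (N : ℝ)⁻¹ * (p : ℝ) * Real.log (p : ℝ) ^ (s + 1) with hE
  have hE1 : 1 / (p : ℝ) ≤ 2 ^ (s + 1) * E := by
    have h1 : (1 : ℝ) ≤ (2 * Real.log p) ^ (s + 1) := one_le_pow₀ (by linarith)
    have h2 : 1 / (p : ℝ) ≤ (N : ℝ)⁻¹ * p := by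
      rw [inv_mul_eq_div, div_le_div_iff₀ hp0 hNR]
      linarith
    calc 1 / (p : ℝ) ≤ (N : ℝ)⁻¹ * p * 1 := by rwa [mul_one]
      _ ≤ (N : ℝ)⁻¹ * p * (2 * Real.log p) ^ (s + 1) := by gcongr
      _ = _ := by rw [hE, mul_pow]; ring
  have hE2 : s / (p : ℝ) ≤ s * 2 ^ (s + 1) * E := by
    calc s / (p : ℝ) = s * (1 / p) := by ring
      _ ≤ s * (2 ^ (s + 1) * E) := by gcongr
      _ = _ := by ring
  have hE0 : 0 ≤ E := by positivity
  rcases le_total s p with hsp | hsp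
  · refine (discrepancy_fermatPoints_le_of_le hsp M hN0 hN.le).trans ?_
    rw [add_mul]
    refine add_le_add ?_ hE2
    calc 2 * s * p * (2 + 2 * Real.log p) * (2 + Real.log p) ^ s / N ≤
          2 * s * p * (6 * Real.log p) * (5 * Real.log p) ^ s / N := by
          gcongr <;> linarith
      _ = _ := by rw [hE, mul_pow]; ring
  -- For the finitely many `p ≤ s` the trivial bound `1 ≤ s / p` is enough.
  · have h1 : (1 : ℝ) ≤ s / p := by
      rw [le_div_iff₀ hp0, one_mul]
      exact_mod_cast hsp
    have h2 : 0 ≤ 12 * s * 5 ^ s * E := by positivity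
    rw [add_mul]
    linarith [discrepancy_le_one (fermatPoints p s M N)]

theorem corollary12 (s : ℕ) (hs : 1 ≤ s) :
    (∃ C : ℝ, 0 < C ∧ ∀ p : ℕ, p.Prime → ∀ (M : ℤ) (N : ℕ), 1 ≤ N → N < p ^ 2 →
      discrepancy (fermatPoints p s M N) ≤
        C * ((N : ℝ)⁻¹ * (p : ℝ) * Real.log (p : ℝ) ^ (s + 1))) ∧
    (∀ ε : ℝ, 0 < ε → ∀ δ : ℝ, 0 < δ → ∃ p₀ : ℕ, ∀ p : ℕ, p.Prime → p₀ ≤ p →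
      ∀ (M : ℤ) (N : ℕ), (p : ℝ) ^ (1 + ε) ≤ (N : ℝ) → N < p ^ 2 →
        discrepancy (fermatPoints p s M N) ≤ δ) := by
  refine ⟨exists_discrepancy_fermatPoints_le s hs, fun ε hε δ hδ => ?_⟩
  obtain ⟨C, hC, hbound⟩ := exists_discrepancy_fermatPoints_le s hs
  -- Since `p / N ≤ p^(-ε)`, it suffices that `(log p)^(s+1) ≤ (δ / C) p^ε` for large `p`.
  have hlim := (isLittleO_log_rpow_rpow_atTop ((s + 1 : ℕ) : ℝ) hε).comp_tendsto
    tendsto_natCast_atTop_atTop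
  obtain ⟨p₀, hp₀⟩ := Filter.eventually_atTop.1 (hlim.bound (c := δ / C) (by positivity))
  refine ⟨p₀, fun p hp hpp M N hNlow hN => ?_⟩
  have hp0 : (0 : ℝ) < p := by exact_mod_cast hp.pos
  have hpow : (0 : ℝ) < (p : ℝ) ^ (1 + ε) := by positivity
  have hNR : (0 : ℝ) < N := hpow.trans_le hNlow
  have h := hp₀ p hpp
  simp only [Function.comp_apply, Real.rpow_natCast, Real.norm_eq_abs] at h
  rw [abs_of_nonneg (pow_nonneg (Real.log_natCast_nonneg p) _), abs_of_pos (by positivity)] at h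
  refine (hbound p hp M N (by exact_mod_cast hNR) hN).trans ?_
  calc C * ((N : ℝ)⁻¹ * p * Real.log p ^ (s + 1)) ≤
        C * (((p : ℝ) ^ (1 + ε))⁻¹ * p * (δ / C * (p : ℝ) ^ ε)) := by gcongr
    _ = δ := by
      rw [Real.rpow_add hp0, Real.rpow_one]
      field_simp
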